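/- **Theorem (asymptotic impossibility).** Let $p\in\mathbb N$ and $\alpha\in(0,1)$. Let $\mathcal E$ be the class of probability distributions $P$ of $(X,Y(1),Y(0),T)$ on $\mathbb R^p\times\mathbb R^2\times\{0,1\}$ such that the law of at least one coordinate of $X$ is absolutely continuous with respect to Lebesgue measure on $\mathbb R$, and $Y(1)$ and $Y(0)$ have continuous (atomless) distributions. Let $\mathcal P_{\mathrm{SI}}$ be the class of $P\in\mathcal E$ under which $(Y(1),Y(0))\perp T\mid X$. Let $\Delta=Y(1)-Y(0)$. For each $n$ let $\widehat C_n$ be a (possibly randomized) prediction set built from $n$ observed units: with $Y_i=T_iY_i(1)+(1-T_i)Y_i(0)$, it assigns to the observed data $\mathcal O_n=\{(X_i,Y_i,T_i)\}_{i=1}^n$, an auxiliary random element $U_n$ with a fixed law not depending on $P$, and a point $x\in\mathbb R^p$ a set $\widehat C_n(x)=\widehat C_n(x;\mathcal O_n,U_n)\subseteq\mathbb R$ such that $(\mathcal O_n,U_n,x,y)\mapsto\mathbf 1\{y\in\widehat C_n(x)\}$ is jointly measurable. Let $\mathbb P_P$ and $\mathbb E_P$ refer to the experiment in which the $n$ sample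 units and a new unit $(X,Y(1),Y(0),T)$ are i.i.d. from $P$ and $U_n$ is independent of them. Suppose that $$\limsup_{n\to\infty}\ \sup_{P\in\mathcal P_{\mathrm{SI}}}\mathbb P_P\bigl(\Delta\notin\widehat C_n(X)\bigr)\le\alpha .$$ Then for every $P\in\mathcal P_{\mathrm{SI}}$ and every $y\in\mathbb R$, $$\limsup_{n\to\infty}\ \mathbb P_P\bigl(y\notin\widehat C_n(X)\bigr)\le\alpha ,$$ and, for every $P\in\mathcal P_{\mathrm{SI}}$, with $\mathrm{length}$ denoting Lebesgue measure on $\mathbb R$ (values in $[0,\infty]$), $$\lim_{n\to\infty}\ \mathbb E_P\bigl[\mathrm{length}\bigl(\widehat C_n(X)\bigr)\bigr]=\infty .$$ -/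

import Mathlib

open MeasureTheory ProbabilityTheory Filter Topology
open scoped ENNReal

/-- The full data of one unit, `(X, (Y(1), Y(0)), T)`; `T = true` stands for "treated" (`T = 1`). -/
abbrev FullData (p : ℕ) : Type := (Fin p → ℝ) × (ℝ × ℝ) × Bool

/-- The observed data of one unit, `(X, Y, T)`. -/
abbrev ObsData (p : ℕ) : Type := (Fin p → ℝ) × ℝ × Bool

namespace FullData

variable {p : ℕ}

/-- The covariates `X`. -/
def cov (o : FullData p) : Fin p → ℝ := o.1

/-- The pair of potential outcomes `(Y(1), Y(0))`. -/
def outcomes (o : FullData p) : ℝ × ℝ := o.2.1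

/-- The potential outcome `Y(1)` under treatment. -/
def y1 (o : FullData p) : ℝ := o.2.1.1

/-- The potential outcome `Y(0)` under control. -/
def y0 (o : FullData p) : ℝ := o.2.1.2

/-- The treatment indicator `T`. -/
def treat (o : FullData p) : Bool := o.2.2

/-- The individual treatment effect `Δ = Y(1) - Y(0)`. -/
def effect (o : FullData p) : ℝ := o.y1 - o.y0

/-- The observation `(X, Y, T)` with `Y = T Y(1) + (1 - T) Y(0)`. -/
def observe (o : FullData p) : ObsData p :=
  (o.cov, if o.treat then o.y1 else o.y0, o.treat)

theorem measurable_cov : Measurable (cov : FullData p → Fin p → ℝ) := measurable_fst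

end FullData

/-- The class `𝓔` of laws of `(X, Y(1), Y(0), T)` for which the law of at least one coordinate of
`X` is absolutely continuous with respect to Lebesgue measure on `ℝ`, and `Y(1)` and `Y(0)` have
continuous distributions (no atoms). That `T` is binary is built into `FullData`. -/
def baseClass (p : ℕ) : Set (ProbabilityMeasure (FullData p)) :=
  {P | (∃ j : Fin p, (P : Measure (FullData p)).map (fun o => o.cov j) ≪ (volume : Measure ℝ)) ∧
    (∀ a : ℝ, (P : Measure (FullData p)) {o | o.y1 = a} = 0) ∧
    (∀ a : ℝ, (P : Measure (FullData p)) {o | o.y0 = a} = 0)}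

/-- The strong-ignorability class: the laws in `baseClass p` under which `(Y(1), Y(0))` and `T` are
conditionally independent given `X`. -/
def strongIgnorabilityClass (p : ℕ) : Set (ProbabilityMeasure (FullData p)) :=
  {P | P ∈ baseClass p ∧
    CondIndepFun (MeasurableSpace.comap (FullData.cov : FullData p → Fin p → ℝ) inferInstance)
      FullData.measurable_cov.comap_le FullData.outcomes FullData.treat
      (P : Measure (FullData p))}

/-- A (possibly randomized) prediction set built from `n` observed units, with auxiliary
randomness in `Ω`: a map sending the observed sample, the auxiliary randomness and a covariate
vector to a subset of `ℝ`, such that the indicator of `y ∈ C(x)` is jointly measurable in all its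
arguments (in particular every value is a Borel set). -/
structure PredictionSet (p n : ℕ) (Ω : Type*) [MeasurableSpace Ω] where
  /-- The prediction set at a covariate vector, given the sample and the auxiliary randomness. -/
  set : (Fin n → ObsData p) → Ω → (Fin p → ℝ) → Set ℝ
  /-- Joint measurability of the indicator of `y ∈ C(x)`. -/
  measurableSet_graph : MeasurableSet
    {q : (Fin n → ObsData p) × Ω × (Fin p → ℝ) × ℝ | q.2.2.2 ∈ set q.1 q.2.1 q.2.2.1}

section

variable {p n : ℕ} {Ω : Type*} [MeasurableSpace Ω]

/-- The joint law of the full data of `n` i.i.d. units from `P`, the auxiliary randomness (law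
`ν`), and the full data of one new unit from `P`, all independent. -/
noncomputable def jointLaw (P : ProbabilityMeasure (FullData p)) (n : ℕ) (ν : Measure Ω) :
    Measure ((Fin n → FullData p) × Ω × FullData p) :=
  (Measure.pi fun _ : Fin n => (P : Measure (FullData p))).prod
    (ν.prod (P : Measure (FullData p)))

/-- The prediction set `Ĉ_n(X)` for the new unit: it is computed from the observed part of the
sample only, and evaluated at the covariates of the new unit. -/
def PredictionSet.forNewUnit (C : PredictionSet p n Ω)
    (w : (Fin n → FullData p) × Ω × FullData p) : Set ℝ :=
  C.set (fun i => (w.1 i).observe) w.2.1 w.2.2.cov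

end

/-!
If `T` is a function of `X`, then `(Y(1), Y(0))` and `T` are conditionally independent given `X`
whatever the law of the potential outcomes. The unobserved outcome can therefore be reset so that
`Δ = y`: the observed data and the prediction set do not change, and a valid prediction set has to
contain `y` as if it were the true effect.

A finite sample cannot exclude that `T` is a function of `X`. As `X` has no atoms, its space can be
cut into so many cells that `n + 1` units most likely lie in different cells. Draw for every cell an
independent label from the conditional law of `T` given the cell, and condition `T` on being that
label: on samples without two units in the same cell, the average over the labels of the law of such
a sample is the original one. So `y` is missed with probability at most the worst-case probability
`s` of missing the effect, and by Tonelli's theorem the expected length is at least `1 - s` times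
the length of `ℝ`.
-/

/-- The density, relative to `μ`, of the law obtained by conditioning `μ` on the label `t` being
`θ c`, within each level set of `c`, while keeping the law of `c`. -/
noncomputable def labelDensity {Z E β : Type*} [MeasurableSpace Z] [MeasurableSpace E]
    [MeasurableSpace β] [StandardBorelSpace β] [Nonempty β] (μ : Measure Z) [IsFiniteMeasure μ]
    (c : Z → E) (t : Z → β) (θ : E → β) : Z → ℝ≥0∞ :=
  {z | t z = θ (c z)}.indicator fun z => (condDistrib t c μ (c z) {t z})⁻¹

/-- The law obtained from `μ` by conditioning the label `t` to be `θ c`, while keeping the law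
of `c`. It has the mass of `μ` only if `θ` avoids the labels of conditional probability zero. -/
noncomputable def labelCond {Z E β : Type*} [MeasurableSpace Z] [MeasurableSpace E]
    [MeasurableSpace β] [StandardBorelSpace β] [Nonempty β] (μ : Measure Z) [IsFiniteMeasure μ]
    (c : Z → E) (t : Z → β) (θ : E → β) : Measure Z :=
  μ.withDensity (labelDensity μ c t θ)

section Pi

theorem measurableSet_not_injective_comp {κ Z ι : Type*} [Finite κ] [MeasurableSpace Z]
    [MeasurableSpace ι] [Countable ι] [MeasurableSingletonClass ι] {c : Z → ι} (hc : Measurable c) :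
    MeasurableSet {z : κ → Z | ¬ Function.Injective (c ∘ z)} :=
  (MeasurableSet.of_discrete (s := {i : κ → ι | ¬ Function.Injective i})).preimage
    (measurable_pi_lambda _ fun k => hc.comp (measurable_pi_apply k))

variable {κ : Type*} [Fintype κ]

theorem lintegral_pi_prod {Z : κ → Type*} [∀ k, MeasurableSpace (Z k)] {μ : ∀ k, Measure (Z k)}
    [∀ k, IsProbabilityMeasure (μ k)] {f : ∀ k, Z k → ℝ≥0∞} (hf : ∀ k, Measurable (f k)) :
    ∫⁻ z, ∏ k, f k (z k) ∂Measure.pi μ = ∏ k, ∫⁻ x, f k x ∂μ k := by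
  rw [lintegral_prod_eq_prod_lintegral_of_indepFun _ _
    (iIndepFun_pi fun k => (hf k).aemeasurable) fun k => (hf k).comp (measurable_pi_apply k)]
  exact Finset.prod_congr rfl fun k _ => (measurePreserving_eval μ k).lintegral_comp (hf k)

theorem pi_withDensity {Z : κ → Type*} [∀ k, MeasurableSpace (Z k)] {μ : ∀ k, Measure (Z k)}
    [∀ k, IsProbabilityMeasure (μ k)] {f : ∀ k, Z k → ℝ≥0∞} (hf : ∀ k, Measurable (f k))
    [∀ k, SigmaFinite ((μ k).withDensity (f k))] :
    (Measure.pi fun k => (μ k).withDensity (f k))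
      = (Measure.pi μ).withDensity fun z => ∏ k, f k (z k) := by
  refine Measure.pi_eq fun s hs => ?_
  have hind (z : ∀ k, Z k) : (Set.univ.pi s).indicator (fun z => ∏ k, f k (z k)) z
      = ∏ k, (s k).indicator (f k) (z k) := by
    classical
    simp only [Set.indicator_apply, Set.mem_univ_pi, Finset.prod_ite_zero, Finset.mem_univ,
      true_implies]
  simp only [withDensity_apply _ (MeasurableSet.univ_pi hs), withDensity_apply _ (hs _),
    ← lintegral_indicator (MeasurableSet.univ_pi hs), ← lintegral_indicator (hs _), hind]
  exact lintegral_pi_prod fun k => (hf k).indicator (hs k)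

theorem ae_pi_injective {E : Type*} [MeasurableSpace E] [MeasurableEq E] {ρ : κ → Measure E}
    [∀ k, IsProbabilityMeasure (ρ k)] [∀ k, NullSingletonClass (ρ k)] :
    ∀ᵐ x ∂Measure.pi ρ, Function.Injective x := by
  have hne (k l : κ) (hkl : k ≠ l) : ∀ᵐ x ∂Measure.pi ρ, x k ≠ x l := by
    have hpair : (Measure.pi ρ).map (fun x => (x k, x l)) = (ρ k).prod (ρ l) := by
      rw [← Measure.infinitePi_eq_pi, Measure.infinitePi_map_eval_prod hkl]
    have hdiag : ∀ᵐ q ∂(ρ k).prod (ρ l), q.1 ≠ q.2 :=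
      (Measure.ae_prod_iff_ae_ae (measurableSet_eq_fun measurable_fst measurable_snd).compl).2
        (ae_of_all _ fun a => (Measure.ae_ne (ρ l) a).mono fun _ => Ne.symm)
    rw [← hpair] at hdiag
    exact ae_of_ae_map (p := fun q : E × E => q.1 ≠ q.2) (by fun_prop) hdiag
  filter_upwards [ae_all_iff.2 fun k => ae_all_iff.2 fun l => ae_all_iff.2 (hne k l)]
    with x hx k l hkl
  exact not_imp_not.1 (hx k l) hkl

/-- The cells are given by finitely many digits of an injection of `E` into the Cantor space. -/
theorem exists_measurable_measure_pi_not_injective_comp_lt {E : Type*} [MeasurableSpace E]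
    [MeasurableSpace.CountablySeparated E] (ρ : κ → Measure E)
    [∀ k, IsProbabilityMeasure (ρ k)] [∀ k, NullSingletonClass (ρ k)] {ε : ℝ≥0∞} (hε : 0 < ε) :
    ∃ (m : ℕ) (c : E → Fin m → Bool), Measurable c ∧
      Measure.pi ρ {x | ¬ Function.Injective (c ∘ x)} < ε := by
  obtain ⟨f, hf, hf_inj⟩ := MeasurableSpace.measurable_injection_nat_bool_of_countablySeparated E
  let c (m : ℕ) (x : E) (i : Fin m) : Bool := f x i
  have hc (m : ℕ) : Measurable (c m) := by fun_prop
  have : MeasurableEq E := ⟨by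
    convert! measurableSet_eq_fun (hf.comp measurable_fst) (hf.comp measurable_snd) using 1
    ext q
    exact hf_inj.eq_iff.symm⟩
  have hsep (x y : E) (hxy : x ≠ y) : ∀ᶠ m in atTop, c m x ≠ c m y := by
    obtain ⟨i, hi⟩ := Function.ne_iff.1 (hf_inj.ne hxy)
    filter_upwards [eventually_gt_atTop i] with m hm h
    exact hi (congrFun h ⟨i, hm⟩)
  have hlim : Tendsto (fun m => Measure.pi ρ {x | ¬ Function.Injective (c m ∘ x)}) atTop (𝓝 0) := by
    rw [← measure_empty (μ := Measure.pi ρ)]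
    refine tendsto_measure_of_ae_tendsto_indicator_of_isFiniteMeasure _ .empty
      (fun m => measurableSet_not_injective_comp (hc m)) ?_
    filter_upwards [ae_pi_injective (ρ := ρ)] with x hx
    have hall : ∀ᶠ m in atTop, ∀ k l, k ≠ l → c m (x k) ≠ c m (x l) := by
      simp only [eventually_all]
      exact fun k l hkl => hsep _ _ (hx.ne hkl)
    filter_upwards [hall] with m hm
    exact iff_of_false (not_not.2 fun k l => not_imp_not.1 (hm k l)) (Set.notMem_empty x)
  obtain ⟨m, hm⟩ := (hlim.eventually_lt_const hε).exists
  exact ⟨m, c m, hc m, hm⟩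

end Pi

section LabelConditioning

variable {Z E β : Type*} [MeasurableSpace Z] [MeasurableSpace E] [MeasurableSpace β]
  [Countable β] [MeasurableSingletonClass β]

theorem measurable_kernel_apply_singleton (η : Kernel E β) :
    Measurable fun q : E × β => η q.1 {q.2} :=
  measurable_from_prod_countable_left fun b => η.measurable_coe (measurableSet_singleton b)

variable [Nonempty β] {μ : Measure Z} [IsFiniteMeasure μ] {c : Z → E} {t : Z → β}

theorem ae_condDistrib_apply_singleton_ne_zero (hc : Measurable c) (ht : Measurable t) :
    ∀ᵐ z ∂μ, condDistrib t c μ (c z) {t z} ≠ 0 := by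
  have hjoint : ∀ᵐ q ∂(μ.map c ⊗ₘ condDistrib t c μ), condDistrib t c μ q.1 {q.2} ≠ 0 :=
    Measure.ae_compProd_of_ae_ae
      (measurable_kernel_apply_singleton _ (measurableSet_singleton 0).compl)
      (ae_of_all _ fun _ => ae_iff_of_countable.2 fun _ h => h)
  rw [compProd_map_condDistrib ht.aemeasurable] at hjoint
  exact ae_of_ae_map (hc.prodMk ht).aemeasurable hjoint

theorem measurable_labelDensity (hc : Measurable c) (ht : Measurable t) {θ : E → β}
    (hθ : Measurable θ) : Measurable (labelDensity μ c t θ) :=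
  ((measurable_kernel_apply_singleton _).comp (hc.prodMk ht)).inv.indicator
    (measurableSet_eq_fun ht (hθ.comp hc))

theorem lintegral_labelDensity (hc : Measurable c) (ht : Measurable t) {θ : E → β}
    (hθ : Measurable θ) (hpos : ∀ᵐ x ∂μ.map c, condDistrib t c μ x {θ x} ≠ 0) :
    ∫⁻ z, labelDensity μ c t θ z ∂μ = μ Set.univ := by
  let f : E × β → ℝ≥0∞ :=
    {q | q.2 = θ q.1}.indicator fun q => (condDistrib t c μ q.1 {q.2})⁻¹
  have hf : Measurable f := (measurable_kernel_apply_singleton _).inv.indicator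
    (measurableSet_eq_fun measurable_snd (hθ.comp measurable_fst))
  have hfiber : ∀ᵐ x ∂μ.map c, ∫⁻ b, f (x, b) ∂condDistrib t c μ x = 1 := by
    filter_upwards [hpos] with x hx
    have hsection (b : β) :
        f (x, b) = ({θ x} : Set β).indicator (fun _ => (condDistrib t c μ x {θ x})⁻¹) b := by
      by_cases hb : b = θ x <;> simp [f, Set.indicator, hb]
    simp only [hsection]
    rw [lintegral_indicator_const (measurableSet_singleton _),
      ENNReal.inv_mul_cancel hx (measure_ne_top _ _)]
  calc ∫⁻ z, labelDensity μ c t θ z ∂μ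
      = ∫⁻ q, f q ∂(μ.map fun z => (c z, t z)) := (lintegral_map hf (hc.prodMk ht)).symm
    _ = ∫⁻ x, ∫⁻ b, f (x, b) ∂condDistrib t c μ x ∂μ.map c := by
        rw [← compProd_map_condDistrib ht.aemeasurable, Measure.lintegral_compProd hf]
    _ = μ Set.univ := by
        rw [lintegral_congr_ae hfiber, lintegral_one, Measure.map_apply hc .univ, Set.preimage_univ]

theorem isProbabilityMeasure_labelCond {μ : Measure Z} [IsProbabilityMeasure μ]
    (hc : Measurable c) (ht : Measurable t) {θ : E → β} (hθ : Measurable θ)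
    (hpos : ∀ᵐ x ∂μ.map c, condDistrib t c μ x {θ x} ≠ 0) :
    IsProbabilityMeasure (labelCond μ c t θ) :=
  ⟨by rw [labelCond, withDensity_apply _ .univ, Measure.restrict_univ,
    lintegral_labelDensity hc ht hθ hpos, measure_univ]⟩

theorem ae_labelCond_eq (hc : Measurable c) (ht : Measurable t) {θ : E → β} (hθ : Measurable θ) :
    ∀ᵐ z ∂labelCond μ c t θ, t z = θ (c z) :=
  (ae_withDensity_iff (measurable_labelDensity hc ht hθ)).2
    (ae_of_all _ fun _ => Set.mem_of_indicator_ne_zero)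

theorem ae_infinitePi_condDistrib_apply_singleton_ne_zero [Countable E] :
    ∀ᵐ θ ∂Measure.infinitePi (condDistrib t c μ), ∀ x, condDistrib t c μ x {θ x} ≠ 0 :=
  ae_all_iff.2 fun x =>
    (measurePreserving_eval_infinitePi (condDistrib t c μ) x).quasiMeasurePreserving.ae
      (p := fun b => condDistrib t c μ x {b} ≠ 0) (ae_iff_of_countable.2 fun _ h => h)

variable {κ : Type*} [Fintype κ]

theorem lintegral_infinitePi_prod_labelDensity {z : κ → Z} (hz : Function.Injective (c ∘ z))
    (hpos : ∀ k, condDistrib t c μ (c (z k)) {t (z k)} ≠ 0) :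
    ∫⁻ θ, ∏ k, labelDensity μ c t θ (z k) ∂Measure.infinitePi (condDistrib t c μ) = 1 := by
  let f (k : κ) : β → ℝ≥0∞ :=
    ({t (z k)} : Set β).indicator fun _ => (condDistrib t c μ (c (z k)) {t (z k)})⁻¹
  have hf (k : κ) : Measurable (f k) := .of_discrete
  have hdensity (k : κ) (θ : E → β) : labelDensity μ c t θ (z k) = f k (θ (c (z k))) := by
    by_cases h : t (z k) = θ (c (z k)) <;> simp [labelDensity, f, Set.indicator, h, eq_comm]
  have hindep : iIndepFun (fun k θ => f k (θ (c (z k)))) (Measure.infinitePi (condDistrib t c μ)) :=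
    ((iIndepFun_infinitePi (P := condDistrib t c μ) (X := fun _ b => b)
      fun _ => measurable_id).precomp hz).comp f hf
  have hone (k : κ) :
      ∫⁻ θ, f k (θ (c (z k))) ∂Measure.infinitePi (condDistrib t c μ) = 1 := by
    rw [(measurePreserving_eval_infinitePi (condDistrib t c μ) (c (z k))).lintegral_comp (hf k),
      lintegral_indicator_const (measurableSet_singleton _),
      ENNReal.inv_mul_cancel (hpos k) (measure_ne_top _ _)]
  simp only [hdensity]
  rw [lintegral_prod_eq_prod_lintegral_of_indepFun _ _ hindep fun k => by fun_prop]
  simp only [hone, Finset.prod_const_one]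

end LabelConditioning

section RandomLabels

variable {Z ι β κ : Type*} [MeasurableSpace Z] [MeasurableSpace ι] [MeasurableSpace β]
  [Countable ι] [MeasurableSingletonClass ι] [Countable β] [MeasurableSingletonClass β]
  [Nonempty β] [Fintype κ] {c : Z → ι} {t : Z → β}

theorem measurable_prod_labelDensity {μ : Measure Z} [IsFiniteMeasure μ]
    (hc : Measurable c) (ht : Measurable t) :
    Measurable fun q : (κ → Z) × (ι → β) => ∏ k, labelDensity μ c t q.2 (q.1 k) := by
  have heval : Measurable fun q : ι × (ι → β) => q.2 q.1 :=
    measurable_from_prod_countable_right fun i => measurable_pi_apply i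
  have hdensity : Measurable fun q : Z × (ι → β) => labelDensity μ c t q.2 q.1 :=
    ((measurable_kernel_apply_singleton (condDistrib t c μ)).comp
      ((hc.prodMk ht).comp measurable_fst)).inv.indicator
      (measurableSet_eq_fun (ht.comp measurable_fst)
        (heval.comp ((hc.comp measurable_fst).prodMk measurable_snd)))
  have hfactor (k : κ) :
      Measurable fun q : (κ → Z) × (ι → β) => labelDensity μ c t q.2 (q.1 k) :=
    hdensity.comp (f := fun q : (κ → Z) × (ι → β) => (q.1 k, q.2)) (by fun_prop)
  exact Finset.measurable_prod _ fun k _ => hfactor k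

variable {μ : Measure Z} [IsProbabilityMeasure μ]

theorem lintegral_pi_labelCond (hc : Measurable c) (ht : Measurable t) {θ : ι → β}
    (hpos : ∀ i, condDistrib t c μ i {θ i} ≠ 0) {φ : (κ → Z) → ℝ≥0∞} (hφ : Measurable φ) :
    ∫⁻ z, φ z ∂(Measure.pi fun _ => labelCond μ c t θ)
      = ∫⁻ z, (∏ k, labelDensity μ c t θ (z k)) * φ z ∂(Measure.pi fun _ => μ) := by
  have hdensity := measurable_labelDensity (μ := μ) hc ht (Measurable.of_discrete (f := θ))
  have : IsProbabilityMeasure (μ.withDensity (labelDensity μ c t θ)) :=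
    isProbabilityMeasure_labelCond hc ht .of_discrete (ae_of_all _ hpos)
  simp only [labelCond]
  rw [pi_withDensity fun _ => hdensity]
  exact lintegral_withDensity_eq_lintegral_mul _ (by fun_prop) hφ

/-- The bound comes from averaging `hS` over independent labels `θ i` drawn from the conditional
laws of `t` given `c = i`. -/
theorem lintegral_pi_le_add_measure_not_injective (hc : Measurable c) (ht : Measurable t)
    {φ : (κ → Z) → ℝ≥0∞} (hφ : Measurable φ) (hφ_le : ∀ z, φ z ≤ 1) {S : ℝ≥0∞}
    (hS : ∀ θ : ι → β, (∀ i, condDistrib t c μ i {θ i} ≠ 0) →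
      ∫⁻ z, φ z ∂(Measure.pi fun _ => labelCond μ c t θ) ≤ S) :
    ∫⁻ z, φ z ∂(Measure.pi fun _ => μ)
      ≤ S + (Measure.pi fun _ => μ) {z : κ → Z | ¬ Function.Injective (c ∘ z)} := by
  set collision := {z : κ → Z | ¬ Function.Injective (c ∘ z)}
  have hcollision : MeasurableSet collision := measurableSet_not_injective_comp hc
  have hdensity := measurable_prod_labelDensity (κ := κ) (μ := μ) hc ht
  have hbound : ∀ᵐ z ∂(Measure.pi fun _ => μ),
      φ z ≤ (∫⁻ θ, (∏ k, labelDensity μ c t θ (z k)) * φ z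
          ∂Measure.infinitePi (condDistrib t c μ)) + collision.indicator 1 z := by
    have hpos : ∀ᵐ z ∂(Measure.pi fun _ : κ => μ),
        ∀ k, condDistrib t c μ (c (z k)) {t (z k)} ≠ 0 :=
      ae_all_iff.2 fun k => (Measure.quasiMeasurePreserving_eval _ k).ae
        (ae_condDistrib_apply_singleton_ne_zero hc ht)
    filter_upwards [hpos] with z hz
    by_cases hinj : Function.Injective (c ∘ z)
    · have hz_meas : Measurable fun θ => ∏ k, labelDensity μ c t θ (z k) :=
        hdensity.comp measurable_prodMk_left
      rw [lintegral_mul_const _ hz_meas,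
        lintegral_infinitePi_prod_labelDensity hinj hz, one_mul]
      exact le_self_add
    · rw [Set.indicator_of_mem (s := collision) hinj]
      exact (hφ_le z).trans le_add_self
  calc ∫⁻ z, φ z ∂(Measure.pi fun _ => μ)
      ≤ ∫⁻ z, (∫⁻ θ, (∏ k, labelDensity μ c t θ (z k)) * φ z
          ∂Measure.infinitePi (condDistrib t c μ)) + collision.indicator 1 z
          ∂(Measure.pi fun _ => μ) := lintegral_mono_ae hbound
    _ = (∫⁻ θ, ∫⁻ z, (∏ k, labelDensity μ c t θ (z k)) * φ z ∂(Measure.pi fun _ => μ)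
          ∂Measure.infinitePi (condDistrib t c μ)) + (Measure.pi fun _ => μ) collision := by
        rw [lintegral_add_right _ (measurable_one.indicator hcollision),
          lintegral_indicator_one hcollision, lintegral_lintegral_swap]
        exact (hdensity.mul (hφ.comp measurable_fst)).aemeasurable
    _ ≤ (∫⁻ _, S ∂Measure.infinitePi (condDistrib t c μ)) + (Measure.pi fun _ => μ) collision := by
        gcongr ?_ + _
        refine lintegral_mono_ae ?_
        filter_upwards [ae_infinitePi_condDistrib_apply_singleton_ne_zero] with θ hθ
        exact (lintegral_pi_labelCond hc ht hθ hφ).symm.trans_le (hS θ hθ)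
    _ = S + (Measure.pi fun _ => μ) collision := by
        rw [lintegral_const, measure_univ, mul_one]

end RandomLabels

theorem condIndepFun_of_ae_eq_measurable_right {Ω β β' : Type*} {m' mΩ : MeasurableSpace Ω}
    [StandardBorelSpace Ω] {hm' : m' ≤ mΩ} {μ : Measure Ω} [IsFiniteMeasure μ]
    [MeasurableSpace β] [MeasurableSpace β'] {X : Ω → β} {Y Y' : Ω → β'}
    (hX : Measurable X) (hY' : Measurable[m'] Y') (h : Y =ᵐ[μ] Y') :
    CondIndepFun m' hm' X Y μ := by
  refine Kernel.IndepFun.congr' (condIndepFun_of_measurable_right hX hY')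
    (ae_of_all _ fun _ => ae_eq_rfl) (Measure.ae_ae_of_ae_comp ?_)
  rw [condExpKernel_comp_trim]
  exact h.symm

theorem mul_measure_univ_le_lintegral_measure {W E : Type*} [MeasurableSpace W]
    [MeasurableSpace E] {μ : Measure W} [IsProbabilityMeasure μ] {ρ : Measure E} [SFinite ρ]
    {D : W → Set E} (hD : MeasurableSet {q : W × E | q.2 ∈ D q.1}) {s : ℝ≥0∞}
    (hs : ∀ y, μ {w | y ∉ D w} ≤ s) :
    (1 - s) * ρ Set.univ ≤ ∫⁻ w, ρ (D w) ∂μ := by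
  have hcover (y : E) : 1 - s ≤ μ {w | y ∈ D w} := by
    have hy : MeasurableSet {w | y ∈ D w} := hD.preimage measurable_prodMk_right
    rw [← compl_compl {w | y ∈ D w}, prob_compl_eq_one_sub hy.compl]
    exact tsub_le_tsub_left (hs y) 1
  calc (1 - s) * ρ Set.univ = ∫⁻ _, 1 - s ∂ρ := (lintegral_const _).symm
    _ ≤ ∫⁻ y, μ {w | y ∈ D w} ∂ρ := lintegral_mono hcover
    _ = ∫⁻ w, ρ (D w) ∂μ := (Measure.prod_apply_symm hD).symm.trans (Measure.prod_apply hD)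

namespace FullData

variable {p : ℕ} {y : ℝ}

attribute [fun_prop] measurable_cov

@[fun_prop]
theorem measurable_outcomes : Measurable (outcomes : FullData p → ℝ × ℝ) := measurable_snd.fst

@[fun_prop]
theorem measurable_treat : Measurable (treat : FullData p → Bool) := measurable_snd.snd

@[fun_prop]
theorem measurable_y1 : Measurable (y1 : FullData p → ℝ) := measurable_snd.fst.fst

@[fun_prop]
theorem measurable_y0 : Measurable (y0 : FullData p → ℝ) := measurable_snd.fst.snd

@[fun_prop]
theorem measurable_effect : Measurable (effect : FullData p → ℝ) := measurable_y1.sub measurable_y0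

theorem measurableSet_treat : MeasurableSet {o : FullData p | o.treat} :=
  measurable_treat (measurableSet_singleton true)

@[fun_prop]
theorem measurable_observe : Measurable (observe : FullData p → ObsData p) :=
  measurable_cov.prodMk
    ((measurable_y1.ite measurableSet_treat measurable_y0).prodMk measurable_treat)

/-- Keep the observed data of a unit and reset the unobserved potential outcome so that the
treatment effect equals `y`. -/
def imputeEffect (y : ℝ) (o : FullData p) : FullData p :=
  (o.cov, if o.treat then (o.y1, o.y1 - y) else (o.y0 + y, o.y0), o.treat)

@[fun_prop]
theorem measurable_imputeEffect : Measurable (imputeEffect y : FullData p → FullData p) :=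
  measurable_cov.prodMk ((Measurable.ite measurableSet_treat (by fun_prop) (by fun_prop)).prodMk
    measurable_treat)

theorem cov_imputeEffect (o : FullData p) : (o.imputeEffect y).cov = o.cov := rfl

theorem treat_imputeEffect (o : FullData p) : (o.imputeEffect y).treat = o.treat := rfl

theorem y1_imputeEffect (o : FullData p) :
    (o.imputeEffect y).y1 = if o.treat then o.y1 else o.y0 + y :=
  apply_ite Prod.fst _ _ _

theorem y0_imputeEffect (o : FullData p) :
    (o.imputeEffect y).y0 = if o.treat then o.y1 - y else o.y0 :=
  apply_ite Prod.snd _ _ _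

theorem effect_imputeEffect (o : FullData p) : (o.imputeEffect y).effect = y := by
  rw [effect, y1_imputeEffect, y0_imputeEffect]
  split <;> ring

theorem observe_imputeEffect (o : FullData p) : (o.imputeEffect y).observe = o.observe := by
  rw [observe, observe, y1_imputeEffect, y0_imputeEffect, treat_imputeEffect, cov_imputeEffect]
  cases o.treat <;> rfl

end FullData

section BaseClass

variable {p : ℕ} {P Q : ProbabilityMeasure (FullData p)}

theorem mem_baseClass_of_absolutelyContinuous (hP : P ∈ baseClass p)
    (hQP : (Q : Measure (FullData p)) ≪ P) : Q ∈ baseClass p :=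
  let ⟨⟨j, hj⟩, hy1, hy0⟩ := hP
  ⟨⟨j, (hQP.map (by fun_prop)).trans hj⟩, fun a => hQP (hy1 a), fun a => hQP (hy0 a)⟩

theorem map_imputeEffect_mem_baseClass (hP : P ∈ baseClass p) (y : ℝ) :
    P.map (FullData.measurable_imputeEffect (y := y)).aemeasurable ∈ baseClass p := by
  obtain ⟨⟨j, hj⟩, hy1, hy0⟩ := hP
  refine ⟨⟨j, ?_⟩, fun a => ?_, fun a => ?_⟩
  · rwa [ProbabilityMeasure.toMeasure_map, Measure.map_map (by fun_prop) (by fun_prop)]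
  · have hset : MeasurableSet {o : FullData p | o.y1 = a} :=
      FullData.measurable_y1 (measurableSet_singleton a)
    rw [ProbabilityMeasure.toMeasure_map, Measure.map_apply (by fun_prop) hset]
    refine measure_mono_null (fun o ho => ?_) (measure_union_null (hy1 a) (hy0 (a - y)))
    have ho : (o.imputeEffect y).y1 = a := ho
    rw [FullData.y1_imputeEffect] at ho
    split at ho
    · exact .inl ho
    · exact .inr (eq_sub_of_add_eq ho)
  · have hset : MeasurableSet {o : FullData p | o.y0 = a} :=
      FullData.measurable_y0 (measurableSet_singleton a)
    rw [ProbabilityMeasure.toMeasure_map, Measure.map_apply (by fun_prop) hset]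
    refine measure_mono_null (fun o ho => ?_) (measure_union_null (hy1 (a + y)) (hy0 a))
    have ho : (o.imputeEffect y).y0 = a := ho
    rw [FullData.y0_imputeEffect] at ho
    split at ho
    · exact .inl (eq_add_of_sub_eq ho)
    · exact .inr ho

theorem mem_strongIgnorabilityClass_of_ae_treat_eq (hP : P ∈ baseClass p)
    {h : (Fin p → ℝ) → Bool} (hh : Measurable h)
    (htreat : ∀ᵐ o ∂(P : Measure (FullData p)), o.treat = h o.cov) :
    P ∈ strongIgnorabilityClass p :=
  ⟨hP, condIndepFun_of_ae_eq_measurable_right FullData.measurable_outcomes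
    (hh.comp (comap_measurable _)) htreat⟩

theorem nullSingletonClass_map_cov (hP : P ∈ baseClass p) :
    NullSingletonClass ((P : Measure (FullData p)).map FullData.cov) := by
  obtain ⟨j, hj⟩ := hP.1
  refine ⟨fun x => ?_⟩
  have hcoord := hj (Real.volume_singleton (a := x j))
  rw [Measure.map_apply (by fun_prop) (measurableSet_singleton _)] at hcoord
  rw [Measure.map_apply FullData.measurable_cov (measurableSet_singleton x)]
  exact measure_mono_null (fun o ho => congrFun ho j) hcoord

theorem exists_measurable_measure_pi_not_injective_cov_lt (hP : P ∈ baseClass p) (κ : Type*)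
    [Fintype κ] {ε : ℝ≥0∞} (hε : 0 < ε) :
    ∃ (m : ℕ) (c : (Fin p → ℝ) → Fin m → Bool), Measurable c ∧
      (Measure.pi fun _ : κ => (P : Measure (FullData p)))
        {z | ¬ Function.Injective ((c ∘ FullData.cov) ∘ z)} < ε := by
  have := nullSingletonClass_map_cov hP
  have hcov := FullData.measurable_cov.measurePreserving (P : Measure (FullData p))
  have := Measure.isProbabilityMeasure_map (μ := (P : Measure (FullData p)))
    FullData.measurable_cov.aemeasurable
  obtain ⟨m, c, hc, hlt⟩ := exists_measurable_measure_pi_not_injective_comp_lt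
    (fun _ : κ => (P : Measure (FullData p)).map FullData.cov) hε
  refine ⟨m, c, hc, ?_⟩
  rwa [← (measurePreserving_pi _ _ fun _ => hcov).measure_preimage
    (measurableSet_not_injective_comp hc).nullMeasurableSet] at hlt

end BaseClass

section JointLaw

variable {p n : ℕ} {Ω : Type*} [MeasurableSpace Ω] {ν : Measure Ω} [IsProbabilityMeasure ν]

instance isProbabilityMeasure_jointLaw (P : ProbabilityMeasure (FullData p)) :
    IsProbabilityMeasure (jointLaw P n ν) := by
  unfold jointLaw
  infer_instance

theorem measurePreserving_jointLaw (P : ProbabilityMeasure (FullData p)) :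
    MeasurePreserving
      (fun q : (Fin (n + 1) → FullData p) × Ω => (Fin.tail q.1, q.2, q.1 0))
      ((Measure.pi fun _ => (P : Measure (FullData p))).prod ν) (jointLaw P n ν) := by
  let μ : Measure (FullData p) := P
  have hsplit := (measurePreserving_piFinSuccAbove (fun _ : Fin (n + 1) => μ) 0).prod (.id ν)
  have hrotate := (measurePreserving_prodAssoc (Measure.pi fun _ : Fin n => μ) ν μ).comp
    (Measure.measurePreserving_swap.comp
      (measurePreserving_prodAssoc μ (Measure.pi fun _ : Fin n => μ) ν))
  exact hrotate.comp hsplit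

theorem jointLaw_apply_eq_lintegral_pi (P : ProbabilityMeasure (FullData p))
    {A : Set ((Fin n → FullData p) × Ω × FullData p)} (hA : MeasurableSet A) :
    jointLaw P n ν A = ∫⁻ z, ν {u | (Fin.tail z, u, z 0) ∈ A}
      ∂(Measure.pi fun _ : Fin (n + 1) => (P : Measure (FullData p))) := by
  have hsplit := measurePreserving_jointLaw (n := n) (ν := ν) P
  rw [← hsplit.measure_preimage hA.nullMeasurableSet,
    Measure.prod_apply (hsplit.measurable hA)]
  rfl

theorem measurePreserving_jointLaw_map (P : ProbabilityMeasure (FullData p))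
    {g : FullData p → FullData p} (hg : Measurable g) :
    MeasurePreserving (fun w : (Fin n → FullData p) × Ω × FullData p =>
      (g ∘ w.1, w.2.1, g w.2.2)) (jointLaw P n ν) (jointLaw (P.map hg.aemeasurable) n ν) :=
  have hgP : MeasurePreserving g (P : Measure (FullData p)) (P.map hg.aemeasurable) :=
    hg.measurePreserving _
  (measurePreserving_pi _ _ fun _ => hgP).prod ((MeasurePreserving.id ν).prod hgP)

end JointLaw

namespace PredictionSet

variable {p n : ℕ} {Ω : Type*} [MeasurableSpace Ω] (C : PredictionSet p n Ω)

theorem measurableSet_mem_forNewUnit :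
    MeasurableSet {q : ((Fin n → FullData p) × Ω × FullData p) × ℝ | q.2 ∈ C.forNewUnit q.1} :=
  C.measurableSet_graph.preimage
    (f := fun q : ((Fin n → FullData p) × Ω × FullData p) × ℝ =>
      (fun i => (q.1.1 i).observe, q.1.2.1, q.1.2.2.cov, q.2)) (by fun_prop)

variable {C} in
theorem measurableSet_notMem_forNewUnit {f : (Fin n → FullData p) × Ω × FullData p → ℝ}
    (hf : Measurable f) : MeasurableSet {w | f w ∉ C.forNewUnit w} :=
  (C.measurableSet_mem_forNewUnit.preimage (measurable_id.prodMk hf)).compl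

theorem forNewUnit_imputeEffect (y : ℝ) (w : (Fin n → FullData p) × Ω × FullData p) :
    C.forNewUnit (FullData.imputeEffect y ∘ w.1, w.2.1, w.2.2.imputeEffect y)
      = C.forNewUnit w := by
  simp only [forNewUnit, Function.comp_apply, FullData.observe_imputeEffect,
    FullData.cov_imputeEffect]

/-- The worst-case probability, over the strong-ignorability class, that the prediction set misses
the treatment effect of the new unit. -/
noncomputable def worstMiscoverage (ν : Measure Ω) : ℝ≥0∞ :=
  ⨆ P ∈ strongIgnorabilityClass p, jointLaw P n ν {w | w.2.2.effect ∉ C.forNewUnit w}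

variable {ν : Measure Ω} [IsProbabilityMeasure ν] {P : ProbabilityMeasure (FullData p)}

theorem jointLaw_notMem_le_of_ae_treat_eq (hP : P ∈ baseClass p) {h : (Fin p → ℝ) → Bool}
    (hh : Measurable h) (htreat : ∀ᵐ o ∂(P : Measure (FullData p)), o.treat = h o.cov) (y : ℝ) :
    jointLaw P n ν {w | y ∉ C.forNewUnit w} ≤ C.worstMiscoverage ν := by
  have himpute : Measurable (FullData.imputeEffect y : FullData p → FullData p) := by fun_prop
  have hset : MeasurableSet {o : FullData p | o.treat = h o.cov} :=
    measurableSet_eq_fun FullData.measurable_treat (hh.comp FullData.measurable_cov)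
  have hmem : P.map himpute.aemeasurable ∈ strongIgnorabilityClass p :=
    mem_strongIgnorabilityClass_of_ae_treat_eq (map_imputeEffect_mem_baseClass hP y) hh
      ((ae_map_iff himpute.aemeasurable hset).2 htreat)
  have hmiss : jointLaw (P.map himpute.aemeasurable) n ν {w | w.2.2.effect ∉ C.forNewUnit w}
      = jointLaw P n ν {w | y ∉ C.forNewUnit w} := by
    rw [← (measurePreserving_jointLaw_map P himpute).measure_preimage
      (measurableSet_notMem_forNewUnit (by fun_prop)).nullMeasurableSet]
    simp only [Set.preimage_ofPred_eq, FullData.effect_imputeEffect, forNewUnit_imputeEffect]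
  exact hmiss.symm.trans_le (le_iSup₂ (f := fun Q _ =>
    jointLaw Q n ν {w | w.2.2.effect ∉ C.forNewUnit w}) _ hmem)

theorem jointLaw_notMem_le_add_measure_not_injective (hP : P ∈ baseClass p) {ι : Type*}
    [Countable ι] [MeasurableSpace ι] [MeasurableSingletonClass ι] {c : (Fin p → ℝ) → ι}
    (hc : Measurable c) (y : ℝ) :
    jointLaw P n ν {w | y ∉ C.forNewUnit w} ≤ C.worstMiscoverage ν
      + (Measure.pi fun _ : Fin (n + 1) => (P : Measure (FullData p)))
        {z | ¬ Function.Injective ((c ∘ FullData.cov) ∘ z)} := by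
  have hA : MeasurableSet {w | y ∉ C.forNewUnit w} :=
    measurableSet_notMem_forNewUnit measurable_const
  have hcell : Measurable (c ∘ FullData.cov) := hc.comp FullData.measurable_cov
  rw [jointLaw_apply_eq_lintegral_pi P hA]
  refine lintegral_pi_le_add_measure_not_injective hcell FullData.measurable_treat
    (measurable_measure_prodMk_left ((measurePreserving_jointLaw (ν := ν) P).measurable hA))
    (fun _ => prob_le_one) fun θ hθ => ?_
  let Q : ProbabilityMeasure (FullData p) :=
    ⟨labelCond P (c ∘ FullData.cov) FullData.treat θ, isProbabilityMeasure_labelCond hcell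
      FullData.measurable_treat .of_discrete (ae_of_all _ hθ)⟩
  have hQ : Q ∈ baseClass p :=
    mem_baseClass_of_absolutelyContinuous hP (withDensity_absolutelyContinuous _ _)
  exact (jointLaw_apply_eq_lintegral_pi Q hA).symm.trans_le <|
    C.jointLaw_notMem_le_of_ae_treat_eq hQ (Measurable.of_discrete.comp hc)
      (ae_labelCond_eq hcell FullData.measurable_treat .of_discrete) y

theorem jointLaw_notMem_le (hP : P ∈ baseClass p) (y : ℝ) :
    jointLaw P n ν {w | y ∉ C.forNewUnit w} ≤ C.worstMiscoverage ν := by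
  refine ENNReal.le_of_forall_pos_le_add fun ε hε _ => ?_
  obtain ⟨m, c, hc, hlt⟩ := exists_measurable_measure_pi_not_injective_cov_lt hP (Fin (n + 1))
    (ENNReal.coe_pos.2 hε)
  exact (C.jointLaw_notMem_le_add_measure_not_injective hP hc y).trans (by gcongr)

theorem lintegral_volume_forNewUnit_eq_top (hP : P ∈ baseClass p)
    (hlt : C.worstMiscoverage ν < 1) :
    ∫⁻ w, volume (C.forNewUnit w) ∂(jointLaw P n ν) = ∞ := by
  have hle := mul_measure_univ_le_lintegral_measure (ρ := volume) C.measurableSet_mem_forNewUnit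
    fun y => C.jointLaw_notMem_le (ν := ν) hP y
  rwa [Real.volume_univ, ENNReal.mul_top (tsub_pos_of_lt hlt).ne', top_le_iff] at hle

end PredictionSet

theorem mainTheorem8_general {p : ℕ} {α : ℝ≥0∞} (hα : α < 1)
    {Ω : ℕ → Type*} [∀ n, MeasurableSpace (Ω n)]
    (ν : ∀ n, Measure (Ω n)) [∀ n, IsProbabilityMeasure (ν n)]
    (C : ∀ n, PredictionSet p n (Ω n))
    (hvalid : limsup (fun n : ℕ => (C n).worstMiscoverage (ν n)) atTop ≤ α)
    {P : ProbabilityMeasure (FullData p)} (hP : P ∈ baseClass p) :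
    (∀ y : ℝ, limsup (fun n : ℕ => jointLaw P n (ν n) {w | y ∉ (C n).forNewUnit w}) atTop ≤ α) ∧
    ∀ᶠ n : ℕ in atTop, ∫⁻ w, volume ((C n).forNewUnit w) ∂(jointLaw P n (ν n)) = ∞ := by
  refine ⟨fun y => ?_, ?_⟩
  · exact (limsup_le_limsup (.of_forall fun n => (C n).jointLaw_notMem_le hP y)).trans hvalid
  · filter_upwards [eventually_lt_of_limsup_lt (hvalid.trans_lt hα)] with n hn
    exact (C n).lintegral_volume_forNewUnit_eq_top hP hn

theorem mainTheorem8 (p : ℕ) (α : ℝ) (hα0 : 0 < α) (hα1 : α < 1)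
    {Ω : ℕ → Type*} [∀ n, MeasurableSpace (Ω n)]
    (ν : ∀ n, Measure (Ω n)) [∀ n, IsProbabilityMeasure (ν n)]
    (C : ∀ n, PredictionSet p n (Ω n))
    (hvalid :
      limsup (fun n : ℕ => ⨆ P ∈ strongIgnorabilityClass p,
        jointLaw P n (ν n) {w | w.2.2.effect ∉ (C n).forNewUnit w}) atTop ≤ ENNReal.ofReal α)
    (P : ProbabilityMeasure (FullData p)) (hP : P ∈ strongIgnorabilityClass p) :
    (∀ y : ℝ,
      limsup (fun n : ℕ => jointLaw P n (ν n) {w | y ∉ (C n).forNewUnit w}) atTop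
        ≤ ENNReal.ofReal α) ∧
    Tendsto (fun n : ℕ => ∫⁻ w, volume ((C n).forNewUnit w) ∂(jointLaw P n (ν n)))
      atTop (𝓝 ∞) := by
  have ⟨hcover, hlength⟩ := mainTheorem8_general (ENNReal.ofReal_lt_one.2 hα1) ν C hvalid hP.1
  exact ⟨hcover, EventuallyEq.tendsto hlength⟩
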